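/- Let $f:\mathbb{C}\to\mathbb{C}$ be a transcendental entire function, that is, a function holomorphic on all of $\mathbb{C}$ which is not a polynomial. Let the Fatou set $\mathcal{F}_f$ be the set of points $z\in\mathbb{C}$ having a connected open neighbourhood $U$ on which the iterates $\{f^{\circ n}\}_{n\ge 0}$ form a normal family, i.e. every sequence of iterates has a subsequence which either converges locally uniformly on $U$ to a holomorphic function or tends to $\infty$ uniformly on every compact subset of $U$. Let $\mathcal{J}_f=\mathbb{C}\setminus\mathcal{F}_f$ be the Julia set. Then $\mathcal{J}_f\neq\emptyset$. -/

import Mathlib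

open Filter

/-- A transcendental entire function: holomorphic on all of `ℂ` and not a polynomial function. -/
def IsTranscendentalEntire (f : ℂ → ℂ) : Prop :=
  Differentiable ℂ f ∧ ¬ ∃ p : Polynomial ℂ, ∀ z, f z = p.eval z

/-- Normality of a family `S` of holomorphic functions on a domain (connected open set) `U`: every
sequence in `S` has a subsequence which converges locally uniformly on `U` to a holomorphic
function, or which tends to `∞` uniformly on every compact subset of `U`. As `U` is connected, this
is the same as locally uniform subconvergence for the spherical metric. -/
def IsNormalFamilyOn (S : Set (ℂ → ℂ)) (U : Set ℂ) : Prop :=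
  ∀ u : ℕ → ℂ → ℂ, (∀ n, u n ∈ S) → ∃ φ : ℕ → ℕ, StrictMono φ ∧
    ((∃ g : ℂ → ℂ, DifferentiableOn ℂ g U ∧
        TendstoLocallyUniformlyOn (fun n => u (φ n)) g atTop U) ∨
      (∀ K ⊆ U, IsCompact K → ∀ M : ℝ, ∀ᶠ n in atTop, ∀ z ∈ K, M ≤ ‖u (φ n) z‖))

/-- The Fatou set: the points having a connected open neighbourhood on which the iterates of `f`
form a normal family. -/
def fatouSet (f : ℂ → ℂ) : Set ℂ :=
  {z | ∃ U : Set ℂ, IsOpen U ∧ IsConnected U ∧ z ∈ U ∧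
    IsNormalFamilyOn (Set.range fun n : ℕ => f^[n]) U}

/-- The Julia set: the complement of the Fatou set. -/
def juliaSet (f : ℂ → ℂ) : Set ℂ := (fatouSet f)ᶜ

/-! If the Julia set were empty, the iterates would be normal near every point. Let `G` be the set
of points near which all iterates are uniformly bounded. It is open, and normality makes it closed:
a nearby bounded orbit rules out divergence to infinity
(`IsNormalFamilyOn.eventually_norm_iterate_le`). It is nonempty because `f ∘ f` has a fixed point
(`IsTranscendentalEntire.exists_iterate_two_fixed`). So `G` is the whole plane, and by compactness
the iterates are bounded on every disc. But the image of a large disc of radius `R` contains a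
circle about 0 of radius at least `2 * R`, so by the maximum principle the `n`-th iterate reaches
size `2 ^ n * R` on a fixed disc: a contradiction.

The fixed point comes from little Picard and the circles from superlinear growth; both rest on
Schottky's theorem, deduced here from Bloch's. -/

/-! ### Holomorphic logarithms and Bloch's theorem -/

open Metric Set in
/-- A holomorphic function without zeros on a disc has a holomorphic logarithm there. -/
theorem exists_differentiableOn_log_ball {f : ℂ → ℂ} {c : ℂ} {r : ℝ}
    (hf : DifferentiableOn ℂ f (ball c r)) (h0 : ∀ z ∈ ball c r, f z ≠ 0) :
    ∃ g : ℂ → ℂ, DifferentiableOn ℂ g (ball c r) ∧ (∀ z ∈ ball c r, Complex.exp (g z) = f z) ∧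
      g c = Complex.log (f c) := by
  have hd : DifferentiableOn ℂ (fun z => deriv f z / f z) (ball c r) :=
    (hf.deriv isOpen_ball).div hf h0
  obtain ⟨g, hgc, hg⟩ := hd.isExactOn_ball.with_val_at c (Complex.log (f c))
  refine ⟨g, fun z hz => (hg z hz).differentiableAt.differentiableWithinAt, fun z hz => ?_, hgc⟩
  have hr : 0 < r := nonempty_ball.1 ⟨z, hz⟩
  have hcb : c ∈ ball c r := mem_ball_self hr
  have key : ∀ w ∈ ball c r, HasDerivAt (fun w => f w * Complex.exp (-g w)) 0 w := by
    intro w hw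
    have h1 := (hf.differentiableAt (isOpen_ball.mem_nhds hw)).hasDerivAt
    convert! h1.mul (hg w hw).neg.cexp using 1
    field_simp [h0 w hw]
    ring
  have hconst := isOpen_ball.is_const_of_deriv_eq_zero (convex_ball c r).isPreconnected
    (fun w hw => (key w hw).differentiableAt.differentiableWithinAt)
    (fun w hw => (key w hw).deriv) hz hcb
  have h1 : f c * Complex.exp (-g c) = 1 := by
    rw [hgc, Complex.exp_neg, Complex.exp_log (h0 c hcb), mul_inv_cancel₀ (h0 c hcb)]
  simp only [h1] at hconst
  rw [Complex.exp_neg] at hconst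
  exact (eq_of_mul_inv_eq_one hconst).symm

open Metric Set in
/-- If the derivative of `f` on a disc is at most twice as large as at the centre, then the image
of the disc contains a disc of comparable size around the image of the centre. -/
theorem ball_subset_image_of_norm_deriv_le_two_mul {f : ℂ → ℂ} {a : ℂ} {r : ℝ} (hr : 0 < r)
    (hf : DifferentiableOn ℂ f (ball a r)) (ha : deriv f a ≠ 0)
    (hb : ∀ z ∈ ball a r, ‖deriv f z‖ ≤ 2 * ‖deriv f a‖) :
    ball (f a) (r * ‖deriv f a‖ / 24) ⊆ f '' ball a r := by
  have hapos : 0 < ‖deriv f a‖ := norm_pos_iff.2 ha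
  have hsub : closedBall a (r / 6) ⊆ ball a r := closedBall_subset_ball (by linarith)
  have hdd : ∀ z ∈ closedBall a (r / 6), ‖deriv f z - deriv f a‖ ≤ ‖deriv f a‖ / 2 := by
    intro z hz
    -- Schwarz lemma for `deriv f`, which stays within `3 * ‖deriv f a‖` of its central value; the
    -- radius `r / 6` cuts this to one half.
    have := Complex.dist_le_div_mul_dist_of_mapsTo_ball (hf.deriv isOpen_ball)
      (R₂ := 3 * ‖deriv f a‖) (fun w hw => by
        rw [mem_closedBall, dist_eq_norm]
        linarith [norm_sub_le (deriv f w) (deriv f a), hb w hw]) (hsub hz)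
    rw [dist_eq_norm] at this
    refine this.trans ?_
    rw [mem_closedBall] at hz
    calc 3 * ‖deriv f a‖ / r * dist z a ≤ 3 * ‖deriv f a‖ / r * (r / 6) := by gcongr
      _ = ‖deriv f a‖ / 2 := by field_simp; norm_num
  have hlow : ∀ z ∈ sphere a (r / 6), r * ‖deriv f a‖ / 12 ≤ ‖f z - f a‖ := by
    intro z hz
    have hm := (convex_closedBall a (r / 6)).norm_image_sub_le_of_norm_hasDerivWithin_le
      (f := fun z => f z - deriv f a * z) (f' := fun z => deriv f z - deriv f a)
      (fun w hw => by
        have h1 := (hf.differentiableAt (isOpen_ball.mem_nhds (hsub hw))).hasDerivAt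
        simpa using (h1.fun_sub ((hasDerivAt_id w).const_mul (deriv f a))).hasDerivWithinAt)
      hdd (mem_closedBall_self (by positivity)) (sphere_subset_closedBall hz)
    rw [mem_sphere_iff_norm] at hz
    rw [hz] at hm
    have h2 : ‖deriv f a * (z - a)‖ = ‖deriv f a‖ * (r / 6) := by rw [norm_mul, hz]
    have h3 : deriv f a * (z - a) = (f z - f a) -
      ((f z - deriv f a * z) - (f a - deriv f a * a)) := by ring
    rw [h3] at h2
    have h4 := norm_sub_le (f z - f a) ((f z - deriv f a * z) - (f a - deriv f a * a))
    linarith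
  have hfreq : ∃ᶠ z in nhds a, f z ≠ f a := by
    have := ((hf.differentiableAt (isOpen_ball.mem_nhds
      (mem_ball_self hr))).hasDerivAt.eventually_ne (c := f a) ha).frequently
    exact this.filter_mono nhdsWithin_le_nhds
  have hcl : DiffContOnCl ℂ f (ball a (r / 6)) :=
    (hf.mono hsub).diffContOnCl_ball (subset_refl _)
  have h := hcl.ball_subset_image_closedBall (by positivity) hlow hfreq
  rw [show r * ‖deriv f a‖ / 24 = r * ‖deriv f a‖ / 12 / 2 by ring]
  exact h.trans (image_mono hsub)

open Metric Set in
/-- **Bloch's theorem**: the image of a disc of radius `r` contains a disc whose radius is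
bounded below by a fixed multiple of `r` times the derivative at the centre. -/
theorem exists_ball_subset_image_ball {f : ℂ → ℂ} {a : ℂ} {r : ℝ} (hr : 0 < r)
    (hf : DifferentiableOn ℂ f (ball a r)) :
    ∃ w, ball w (r * ‖deriv f a‖ / 96) ⊆ f '' ball a r := by
  by_cases ha : deriv f a = 0
  · exact ⟨0, by simp [ha]⟩
  have hapos : 0 < ‖deriv f a‖ := norm_pos_iff.2 ha
  have hsub : closedBall a (r / 2) ⊆ ball a r := closedBall_subset_ball (by linarith)
  -- At a maximum `p` of this weighted derivative, moving by at most half the distance from `p` to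
  -- the boundary at most doubles `‖deriv f‖`.
  have hcont : ContinuousOn (fun z => (r / 2 - dist z a) * ‖deriv f z‖) (closedBall a (r / 2)) :=
    (by fun_prop : Continuous fun z : ℂ => r / 2 - dist z a).continuousOn.mul
      (((hf.deriv isOpen_ball).continuousOn.mono hsub).norm)
  obtain ⟨p, hp, hmax⟩ := (isCompact_closedBall a (r / 2)).exists_isMaxOn
    ⟨a, mem_closedBall_self (by positivity)⟩ hcont
  have hpa : (r / 2) * ‖deriv f a‖ ≤ (r / 2 - dist p a) * ‖deriv f p‖ := by
    simpa using hmax (mem_closedBall_self (by positivity) : a ∈ closedBall a (r / 2))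
  have hpos : 0 < (r / 2 - dist p a) * ‖deriv f p‖ := lt_of_lt_of_le (by positivity) hpa
  have ht0 : 0 < r / 2 - dist p a := pos_of_mul_pos_left hpos (norm_nonneg _)
  obtain ⟨t, ht⟩ : ∃ t, t = (r / 2 - dist p a) / 2 := ⟨_, rfl⟩
  have htpos : 0 < t := by linarith
  have hp0 : deriv f p ≠ 0 := by
    intro h
    simp [h] at hpos
  have htsub : ball p t ⊆ closedBall a (r / 2) := fun z hz => by
    rw [mem_ball] at hz
    rw [mem_closedBall]
    linarith [dist_triangle z p a]
  refine ⟨f p, ?_⟩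
  have h := ball_subset_image_of_norm_deriv_le_two_mul htpos
    (hf.mono (htsub.trans hsub)) hp0 (fun z hz => by
      have h1 : (r / 2 - dist z a) * ‖deriv f z‖ ≤ (r / 2 - dist p a) * ‖deriv f p‖ :=
        hmax (htsub hz)
      have h2 : t ≤ r / 2 - dist z a := by
        rw [mem_ball] at hz
        linarith [dist_triangle z p a]
      have h3 : t * ‖deriv f z‖ ≤ (r / 2 - dist z a) * ‖deriv f z‖ := by gcongr
      have h4 : r / 2 - dist p a = 2 * t := by linarith
      rw [h4] at h1
      refine le_of_mul_le_mul_left ?_ htpos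
      linarith)
  refine (ball_subset_ball ?_).trans (h.trans (image_mono (htsub.trans hsub)))
  have h4 : r / 2 - dist p a = 2 * t := by linarith
  rw [h4] at hpa
  linarith

/-! ### Schottky's theorem -/

open Metric Set in
/-- A holomorphic function on a disc which omits `1` and `-1` is the hyperbolic cosine of a
holomorphic function, whose value at the centre can be bounded. -/
theorem exists_eq_cosh_of_omits {f : ℂ → ℂ} {c : ℂ} {r : ℝ} (hr : 0 < r)
    (hf : DifferentiableOn ℂ f (ball c r)) (h1 : ∀ z ∈ ball c r, f z ≠ 1)
    (h2 : ∀ z ∈ ball c r, f z ≠ -1) :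
    ∃ g : ℂ → ℂ, DifferentiableOn ℂ g (ball c r) ∧ (∀ z ∈ ball c r, Complex.cosh (g z) = f z) ∧
      ‖g c‖ ≤ 2 * ‖f c‖ + 1 + Real.pi := by
  obtain ⟨l, hl, hle, -⟩ := exists_differentiableOn_log_ball
    (f := fun z => f z ^ 2 - 1) (c := c) (r := r) ((hf.pow 2).sub_const 1) (fun z hz h => by
      have : (f z - 1) * (f z + 1) = 0 := by linear_combination h
      rcases mul_eq_zero.1 this with h | h
      · exact h1 z hz (sub_eq_zero.1 h)
      · exact h2 z hz (eq_neg_of_add_eq_zero_left h))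
  -- `s` is a square root of `f ^ 2 - 1`, so `f + s` and `f - s` are inverse to each other and serve
  -- as `exp g` and `exp (-g)`.
  obtain ⟨s, hs⟩ : ∃ s : ℂ → ℂ, s = fun z => Complex.exp (l z / 2) := ⟨_, rfl⟩
  have hsd : DifferentiableOn ℂ s (ball c r) := by rw [hs]; exact (hl.div_const 2).cexp
  have hs2 : ∀ z ∈ ball c r, (f z + s z) * (f z - s z) = 1 := by
    intro z hz
    have : s z ^ 2 = f z ^ 2 - 1 := by
      rw [← hle z hz, hs, ← Complex.exp_nat_mul]
      congr 1
      push_cast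
      ring
    linear_combination -this
  obtain ⟨g, hg, hge, hgc⟩ := exists_differentiableOn_log_ball (f := fun z => f z + s z)
    (hf.add hsd) (fun z hz => left_ne_zero_of_mul_eq_one (hs2 z hz))
  refine ⟨g, hg, fun z hz => ?_, ?_⟩
  · rw [Complex.cosh, Complex.exp_neg, hge z hz, ← eq_inv_of_mul_eq_one_right (hs2 z hz)]
    ring
  · have hc := hs2 c (mem_ball_self hr)
    have hne : f c + s c ≠ 0 := left_ne_zero_of_mul_eq_one hc
    have hpos : 0 < ‖f c + s c‖ := norm_pos_iff.2 hne
    have hprod : ‖f c + s c‖ * ‖f c - s c‖ = 1 := by rw [← norm_mul, hc, norm_one]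
    have hsum : ‖f c + s c‖ ≤ ‖f c - s c‖ + 2 * ‖f c‖ ∧ ‖f c - s c‖ ≤ ‖f c + s c‖ + 2 * ‖f c‖ := by
      constructor
      · have := norm_sub_le (2 * f c) (f c - s c)
        rw [show 2 * f c - (f c - s c) = f c + s c by ring, norm_mul] at this
        norm_num at this
        linarith
      · have := norm_sub_le (2 * f c) (f c + s c)
        rw [show 2 * f c - (f c + s c) = f c - s c by ring, norm_mul] at this
        norm_num at this
        linarith
    -- The two norms have product 1 and differ by at most `2 * ‖f c‖`, so the smaller is at most 1
    -- and the larger at most `2 * ‖f c‖ + 1`.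
    have hlog : |Real.log ‖f c + s c‖| ≤ 2 * ‖f c‖ + 1 := by
      have hpos' : 0 < ‖f c - s c‖ := by
        by_contra h
        have : ‖f c - s c‖ = 0 := le_antisymm (not_lt.1 h) (norm_nonneg _)
        simp [this] at hprod
      have hn := norm_nonneg (f c)
      have hinv : Real.log ‖f c - s c‖ = - Real.log ‖f c + s c‖ := by
        rw [← Real.log_inv]
        congr 1
        exact eq_inv_of_mul_eq_one_right hprod
      have hA := Real.log_le_sub_one_of_pos hpos
      have hB := Real.log_le_sub_one_of_pos hpos'
      rcases le_total ‖f c + s c‖ ‖f c - s c‖ with h | h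
      · have : ‖f c + s c‖ ≤ 1 := by nlinarith
        rw [abs_le]
        constructor <;> linarith [hsum.1, hsum.2]
      · have : ‖f c - s c‖ ≤ 1 := by nlinarith
        rw [abs_le]
        constructor <;> linarith [hsum.1, hsum.2]
    rw [hgc]
    have h5 := Complex.norm_le_abs_re_add_abs_im (Complex.log (f c + s c))
    rw [Complex.log_re, Complex.log_im] at h5
    linarith [Complex.abs_arg_le_pi (f c + s c)]

/-- The preimages of the positive integers under `cosh` form a net in the plane. -/
theorem exists_cosh_eq_natCast_near (w : ℂ) :
    ∃ a : ℂ, ‖a - w‖ < 6 ∧ ∃ n : ℕ, Complex.cosh a = n := by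
  have hreal : ∀ x : ℝ, 0 ≤ x → ∃ y : ℝ, |y - x| ≤ 2 ∧ ∃ n : ℕ, Real.cosh y = n := by
    intro x hx
    have h1 : 1 ≤ ⌊Real.cosh x⌋₊ := Nat.le_floor (by simp)
    have h1' : (1 : ℝ) ≤ (⌊Real.cosh x⌋₊ : ℝ) := by exact_mod_cast h1
    have hc := Real.cosh_arcosh h1'
    have hy0 := Real.arcosh_nonneg h1'
    refine ⟨Real.arcosh ⌊Real.cosh x⌋₊, ?_, _, hc⟩
    set y := Real.arcosh ⌊Real.cosh x⌋₊
    have hyx : y ≤ x := by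
      have : Real.cosh y ≤ Real.cosh x := by
        rw [hc]; exact Nat.floor_le (Real.cosh_pos x).le
      rw [Real.cosh_le_cosh, abs_of_nonneg hy0, abs_of_nonneg hx] at this
      exact this
    have hxy : x ≤ y + 2 := by
      have h2 : (2 : ℝ) ≤ Real.cosh 2 := by
        have h3 := Real.add_one_le_exp 2
        have h4 := Real.quadratic_le_exp_of_nonneg (x := 2) (by norm_num)
        have h5 := Real.exp_pos (-2)
        rw [Real.cosh_eq]
        linarith
      -- `cosh (y + 2) ≥ 2 * cosh y ≥ cosh y + 1`, which exceeds `cosh x` since `cosh y` is its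
      -- floor.
      have h3 : Real.cosh x ≤ Real.cosh (y + 2) := by
        rw [Real.cosh_add, hc]
        have h4 := Nat.lt_floor_add_one (Real.cosh x)
        have h5 : 0 ≤ Real.sinh y * Real.sinh 2 :=
          mul_nonneg (Real.sinh_nonneg_iff.2 hy0) (Real.sinh_nonneg_iff.2 (by norm_num))
        nlinarith
      rw [Real.cosh_le_cosh, abs_of_nonneg hx, abs_of_nonneg (by linarith)] at h3
      exact h3
    rw [abs_le]
    constructor <;> linarith
  obtain ⟨y, hy, n, hn⟩ : ∃ y : ℝ, |y - w.re| ≤ 2 ∧ ∃ n : ℕ, Real.cosh y = n := by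
    rcases le_total 0 w.re with h | h
    · exact hreal _ h
    · obtain ⟨y, hy, n, hn⟩ := hreal (-w.re) (by linarith)
      refine ⟨-y, ?_, n, by rw [Real.cosh_neg, hn]⟩
      rw [← abs_neg]
      convert hy using 2
      ring
  obtain ⟨m, hm⟩ : ∃ m : ℤ, m = round (w.im / (2 * Real.pi)) := ⟨_, rfl⟩
  have hpi := Real.pi_pos
  refine ⟨y + m * (2 * Real.pi * Complex.I), ?_, n, ?_⟩
  · have him : |m * (2 * Real.pi) - w.im| ≤ Real.pi := by
      have h := abs_sub_round (w.im / (2 * Real.pi))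
      rw [← hm] at h
      have h2 : m * (2 * Real.pi) - w.im = -((w.im / (2 * Real.pi) - m) * (2 * Real.pi)) := by
        field_simp
        ring
      rw [h2, abs_neg, abs_mul, abs_of_pos (by positivity : 0 < 2 * Real.pi)]
      nlinarith
    have h := Complex.norm_le_abs_re_add_abs_im (y + m * (2 * Real.pi * Complex.I) - w)
    have hre : (y + m * (2 * Real.pi * Complex.I) - w).re = y - w.re := by simp
    have him' : (y + m * (2 * Real.pi * Complex.I) - w).im = m * (2 * Real.pi) - w.im := by simp
    rw [hre, him'] at h
    linarith [Real.pi_lt_four]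
  · have hper : Complex.exp (y + m * (2 * Real.pi * Complex.I)) = Complex.exp y :=
      (Complex.exp_periodic.int_mul m) _
    rw [Complex.cosh, Complex.exp_neg, hper, ← Complex.exp_neg, ← Complex.cosh]
    exact_mod_cast hn

open Metric Set in
/-- **Schottky's theorem**: holomorphic functions on the unit disc which omit `0` and `1` are
bounded on the disc of radius `1 / 2` in terms of a bound for the value at the centre. -/
theorem exists_norm_le_of_omits_zero_one (M : ℝ) :
    ∃ C : ℝ, ∀ h : ℂ → ℂ, DifferentiableOn ℂ h (ball 0 1) → (∀ z ∈ ball 0 1, h z ≠ 0) →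
      (∀ z ∈ ball 0 1, h z ≠ 1) → ‖h 0‖ ≤ M → ∀ z ∈ closedBall (0 : ℂ) (1 / 2), ‖h z‖ ≤ C := by
  -- With `2 * h - 1 = cosh F` and `F = π * I * cosh G`, the radius bounds `‖G 0‖` by applying
  -- `exists_eq_cosh_of_omits` twice, plus `576 = 1152 / 2` for the variation of `G`.
  obtain ⟨K, hK⟩ := (isCompact_closedBall (0 : ℂ)
    (2 * (2 * (2 * M + 1) + 1 + Real.pi) + 1 + Real.pi + 576)).bddAbove_image
    (f := fun w => ‖(Complex.cosh (Real.pi * Complex.I * Complex.cosh w) + 1) / 2‖)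
    (by fun_prop)
  refine ⟨K, fun h hh h0 h1 hM z hz => ?_⟩
  have hpi := Real.pi_pos
  have hpiI : (Real.pi * Complex.I : ℂ) ≠ 0 :=
    mul_ne_zero (by exact_mod_cast hpi.ne') Complex.I_ne_zero
  obtain ⟨F, hF, hFc, hF0⟩ := exists_eq_cosh_of_omits (f := fun z => 2 * h z - 1) (c := 0) one_pos
    ((hh.const_mul 2).sub_const 1) (fun z hz e => h1 z hz (by linear_combination e / 2))
    (fun z hz e => h0 z hz (by linear_combination e / 2))
  have hFn : ∀ z ∈ ball (0 : ℂ) 1, ∀ n : ℤ, F z / (Real.pi * Complex.I) ≠ n := by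
    intro z hz n e
    rw [div_eq_iff hpiI] at e
    have hcz := hFc z hz
    have : Complex.cosh (F z) ^ 2 = 1 := by
      rw [e, ← mul_assoc, Complex.cosh_mul_I, Complex.cos_sq', Complex.sin_int_mul_pi]
      ring
    rw [hcz] at this
    have h3 : h z * (h z - 1) = 0 := by linear_combination this / 4
    rcases mul_eq_zero.1 h3 with h4 | h4
    · exact h0 z hz h4
    · exact h1 z hz (sub_eq_zero.1 h4)
  obtain ⟨G, hG, hGc, hG0⟩ := exists_eq_cosh_of_omits
    (f := fun z => F z / (Real.pi * Complex.I)) (c := 0) one_pos (hF.div_const _)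
    (fun z hz e => hFn z hz 1 (by simpa using e)) (fun z hz e => hFn z hz (-1) (by simpa using e))
  have hGomit : ∀ w, ¬ ball w 6 ⊆ G '' ball 0 1 := by
    intro w hw
    obtain ⟨a, ha, n, hn⟩ := exists_cosh_eq_natCast_near w
    obtain ⟨z, hz, rfl⟩ := hw (mem_ball_iff_norm.2 ha)
    exact hFn z hz n (by rw [← hGc z hz, hn]; simp)
  have hsub : closedBall (0 : ℂ) (1 / 2) ⊆ ball 0 1 := closedBall_subset_ball (by norm_num)
  -- Bloch on a disc of radius `1 / 2`: a larger derivative would give an image disc of radius `(1 /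
  -- 2) * 1152 / 96 = 6`.
  have hder : ∀ w ∈ closedBall (0 : ℂ) (1 / 2), ‖deriv G w‖ ≤ 1152 := by
    intro w hw
    by_contra hlt
    push Not at hlt
    have hsw : ball w (1 / 2) ⊆ ball 0 1 := fun x hx => by
      rw [mem_closedBall] at hw
      rw [mem_ball] at hx ⊢
      linarith [dist_triangle x w 0]
    obtain ⟨v, hv⟩ := exists_ball_subset_image_ball (by norm_num : (0 : ℝ) < 1 / 2) (hG.mono hsw)
    exact hGomit v ((ball_subset_ball (by linarith)).trans (hv.trans (image_mono hsw)))
  have hGz := (convex_closedBall (0 : ℂ) (1 / 2)).norm_image_sub_le_of_norm_deriv_le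
    (fun w hw => hG.differentiableAt (isOpen_ball.mem_nhds (hsub hw))) hder
    (mem_closedBall_self (by norm_num)) hz
  rw [mem_closedBall_zero_iff] at hz
  rw [sub_zero] at hGz
  have hF0' : ‖F 0 / (Real.pi * Complex.I)‖ ≤ ‖F 0‖ := by
    rw [norm_div, norm_mul, Complex.norm_I, mul_one, Complex.norm_real, Real.norm_of_nonneg hpi.le]
    exact div_le_self (norm_nonneg _) (by linarith [Real.pi_gt_three])
  have hh0 : ‖2 * h 0 - 1‖ ≤ 2 * M + 1 := by
    have := norm_sub_le (2 * h 0) 1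
    rw [norm_mul] at this
    norm_num at this
    linarith
  have hmem : G z ∈ closedBall (0 : ℂ) (2 * (2 * (2 * M + 1) + 1 + Real.pi) + 1 + Real.pi + 576) := by
    rw [mem_closedBall_zero_iff]
    have := norm_sub_norm_le (G z) (G 0)
    linarith
  have := hK (mem_image_of_mem _ hmem)
  simp only [hGc z (hsub (mem_closedBall_zero_iff.2 hz)), mul_div_cancel₀ _ hpiI,
    hFc z (hsub (mem_closedBall_zero_iff.2 hz))] at this
  rwa [show (2 * h z - 1 + 1) / 2 = h z by ring] at this

/-! ### Little Picard and a fixed point of the second iterate -/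

theorem IsTranscendentalEntire.not_deriv_eq_const {f : ℂ → ℂ} (hf : IsTranscendentalEntire f)
    (d : ℂ) : ¬ ∀ z, deriv f z = d := by
  intro h
  refine hf.2 ⟨Polynomial.C d * Polynomial.X + Polynomial.C (f 0), fun z => ?_⟩
  have key : ∀ w, HasDerivAt (fun w => f w - d * w) 0 w := fun w => by
    simpa [h w] using (hf.1 w).hasDerivAt.fun_sub ((hasDerivAt_id w).const_mul d)
  have := is_const_of_deriv_eq_zero (fun w => (key w).differentiableAt) (fun w => (key w).deriv) z 0
  simp only [mul_zero, sub_zero] at this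
  simp [← this]

open Metric Set in
/-- **Little Picard theorem**, for the omitted values `0` and `1`. -/
theorem Differentiable.exists_const_of_omits_zero_one {h : ℂ → ℂ} (hh : Differentiable ℂ h)
    (h0 : ∀ z, h z ≠ 0) (h1 : ∀ z, h z ≠ 1) : ∃ c, ∀ z, h z = c := by
  obtain ⟨C, hC⟩ := exists_norm_le_of_omits_zero_one ‖h 0‖
  refine hh.exists_const_forall_eq_of_bounded (isBounded_iff_forall_norm_le.2 ⟨C, ?_⟩)
  rintro _ ⟨z, rfl⟩
  have hz : (0 : ℝ) < 2 * (‖z‖ + 1) := by positivity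
  have hne : ((2 * (‖z‖ + 1) : ℝ) : ℂ) ≠ 0 := by exact_mod_cast hz.ne'
  have := hC (fun w => h (((2 * (‖z‖ + 1) : ℝ) : ℂ) * w))
    (hh.comp (differentiable_id.const_mul _)).differentiableOn (fun w _ => h0 _) (fun w _ => h1 _)
    (by simp) (z / ((2 * (‖z‖ + 1) : ℝ) : ℂ)) (by
      rw [mem_closedBall_zero_iff, norm_div, Complex.norm_real, Real.norm_of_nonneg hz.le,
        div_le_iff₀ hz]
      linarith)
  simpa only [mul_div_cancel₀ _ hne] using this

/-- The second iterate of a transcendental entire function has a fixed point. -/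
theorem IsTranscendentalEntire.exists_iterate_two_fixed {f : ℂ → ℂ}
    (hf : IsTranscendentalEntire f) : ∃ c, f (f c) = c := by
  by_contra hno
  push Not at hno
  have hd := hf.1
  have hne : ∀ z, f z - z ≠ 0 := fun z h => hno z (by rw [sub_eq_zero.1 h, sub_eq_zero.1 h])
  -- This quotient omits 0, and also 1, since otherwise `f z` would be fixed by `f`; Picard makes it
  -- a constant `k`.
  have hq : Differentiable ℂ fun z => (f (f z) - z) / (f z - z) :=
    ((hd.comp hd).sub differentiable_id).div (hd.sub differentiable_id) hne
  obtain ⟨k, hk⟩ := hq.exists_const_of_omits_zero_one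
    (fun z => div_ne_zero (sub_ne_zero.2 (hno z)) (hne z))
    (fun z h => hne (f z) (by
      rw [div_eq_one_iff_eq (hne z)] at h
      linear_combination h))
  have hk0 : k ≠ 0 := by
    rw [← hk 0]
    exact div_ne_zero (sub_ne_zero.2 (hno 0)) (hne 0)
  have hk1 : 1 - k ≠ 0 := by
    intro h
    have h2 := hk 0
    rw [← sub_eq_zero.1 h, div_eq_one_iff_eq (hne 0)] at h2
    exact hne (f 0) (by linear_combination h2)
  -- As `k ≠ 1`, neither factor vanishes, so `deriv f ∘ f` omits 0 and `k`. By Picard it is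
  -- constant, and then so is `deriv f`.
  have hder : ∀ z, deriv f z * (deriv f (f z) - k) = 1 - k := by
    intro z
    have e : (fun z => f (f z) - z) = fun z => k * (f z - z) := by
      funext w
      rw [← hk w, div_mul_cancel₀ _ (hne w)]
    have hA : HasDerivAt (fun z => f (f z) - z) (deriv f (f z) * deriv f z - 1) z :=
      ((hd (f z)).hasDerivAt.comp z (hd z).hasDerivAt).fun_sub (hasDerivAt_id z)
    have hB : HasDerivAt (fun z => k * (f z - z)) (k * (deriv f z - 1)) z :=
      ((hd z).hasDerivAt.fun_sub (hasDerivAt_id z)).const_mul k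
    rw [e] at hA
    linear_combination hA.unique hB
  have hd0 : ∀ z, deriv f z ≠ 0 := fun z h => hk1 (by rw [← hder z, h, zero_mul])
  have hdk : ∀ z, deriv f (f z) - k ≠ 0 := fun z h => hk1 (by rw [← hder z, h, mul_zero])
  have hdd : Differentiable ℂ (deriv f) := by
    rw [← differentiableOn_univ]
    exact hd.differentiableOn.deriv isOpen_univ
  obtain ⟨c, hc⟩ := ((hdd.comp hd).div_const k).exists_const_of_omits_zero_one
    (fun z => div_ne_zero (hd0 _) hk0)
    (fun z h => hdk z (by
      rw [div_eq_one_iff_eq hk0] at h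
      exact sub_eq_zero.2 h))
  refine hf.not_deriv_eq_const ((1 - k) / (c * k - k)) fun z => ?_
  have hz : deriv f (f z) = c * k := by rw [← hc z]; exact (div_mul_cancel₀ _ hk0).symm
  have h2 := hdk z
  rw [hz] at h2
  rw [eq_div_iff h2, ← hz, hder z]

/-! ### Growth of the iterates -/

open Metric Set in
/-- A transcendental entire function grows faster than linearly. -/
theorem IsTranscendentalEntire.exists_lt_norm {f : ℂ → ℂ} (hf : IsTranscendentalEntire f)
    (C : ℝ) : ∃ R₀ : ℝ, ∀ R ≥ R₀, ∃ z, ‖z‖ ≤ R / 2 ∧ C * R < ‖f z‖ := by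
  by_contra! hno
  have hdd : Differentiable ℂ (deriv f) := by
    rw [← differentiableOn_univ]
    exact hf.1.differentiableOn.deriv isOpen_univ
  obtain ⟨d, hd⟩ := hdd.exists_const_forall_eq_of_bounded
    (isBounded_iff_forall_norm_le.2 ⟨4 * C, by
      rintro _ ⟨z, rfl⟩
      obtain ⟨R, hR, hb⟩ := hno (4 * ‖z‖ + 1)
      have hRpos : 0 < R := by linarith [norm_nonneg z]
      have := Complex.norm_deriv_le_of_forall_mem_sphere_norm_le (by positivity : 0 < R / 4)
        hf.1.diffContOnCl (c := z) (C := C * R) (fun w hw => hb w (by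
          rw [mem_sphere_iff_norm] at hw
          have := norm_add_le (w - z) z
          rw [sub_add_cancel] at this
          linarith))
      refine this.trans (le_of_eq ?_)
      field_simp⟩)
  exact hf.not_deriv_eq_const d hd

open Metric Set in
/-- The image of a large disc under a transcendental entire function contains a circle around the
origin of at least twice the radius. -/
theorem IsTranscendentalEntire.exists_sphere_subset_image {f : ℂ → ℂ}
    (hf : IsTranscendentalEntire f) :
    ∃ R₀ > 0, ∀ R ≥ R₀, ∃ ρ ≥ 2 * R, sphere 0 ρ ⊆ f '' closedBall 0 R := by
  obtain ⟨C, hC⟩ := exists_norm_le_of_omits_zero_one 2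
  -- If values `a`, `b` of norms `2 * R`, `4 * R` are omitted, Schottky gives `‖f z‖ ≤ ‖a‖ + C * ‖b
  -- - a‖ ≤ (6 * C + 2) * R` for `‖z‖ ≤ R / 2`.
  obtain ⟨R₁, hR₁⟩ := hf.exists_lt_norm (6 * C + 2)
  refine ⟨max R₁ (‖f 0‖ + 1), lt_max_of_lt_right (by positivity), fun R hR => ?_⟩
  have hR0 : ‖f 0‖ + 1 ≤ R := (le_max_right _ _).trans hR
  have hRpos : 0 < R := by linarith [norm_nonneg (f 0)]
  by_contra! hno
  obtain ⟨a, ha, ha'⟩ := not_subset.1 (hno (2 * R) le_rfl)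
  obtain ⟨b, hb, hb'⟩ := not_subset.1 (hno (4 * R) (by linarith))
  rw [mem_sphere_zero_iff_norm] at ha hb
  have hba : 2 * R ≤ ‖b - a‖ := by linarith [norm_sub_norm_le b a]
  have hba' : ‖b - a‖ ≤ 6 * R := by linarith [norm_sub_le b a]
  have hbapos : 0 < ‖b - a‖ := by linarith
  have hne : b - a ≠ 0 := norm_pos_iff.1 hbapos
  have hRne : (R : ℂ) ≠ 0 := by exact_mod_cast hRpos.ne'
  have hmem : ∀ w ∈ ball (0 : ℂ) 1, (R : ℂ) * w ∈ closedBall (0 : ℂ) R := fun w hw => by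
    rw [mem_ball_zero_iff] at hw
    rw [mem_closedBall_zero_iff, norm_mul, Complex.norm_real, Real.norm_of_nonneg hRpos.le]
    nlinarith
  obtain ⟨z, hz, hfz⟩ := hR₁ R ((le_max_left _ _).trans hR)
  have hbound := hC (fun w => (f ((R : ℂ) * w) - a) / (b - a))
    (((hf.1.comp (differentiable_id.const_mul _)).sub_const a).div_const _).differentiableOn
    (fun w hw => div_ne_zero (fun h => ha' ⟨_, hmem w hw, sub_eq_zero.1 h⟩) hne)
    (fun w hw h => hb' ⟨_, hmem w hw, by
      rw [div_eq_one_iff_eq hne] at h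
      linear_combination h⟩)
    (by
      rw [mul_zero, norm_div, div_le_iff₀ hbapos]
      linarith [norm_sub_le (f 0) a])
    (z / R) (by
      rw [mem_closedBall_zero_iff, norm_div, Complex.norm_real, Real.norm_of_nonneg hRpos.le,
        div_le_iff₀ hRpos]
      linarith)
  simp only [mul_div_cancel₀ _ hRne] at hbound
  rw [norm_div, div_le_iff₀ hbapos] at hbound
  have hC0 : 0 ≤ C := by
    by_contra h
    push Not at h
    nlinarith [norm_nonneg (f z - a)]
  have h1 := norm_sub_norm_le (f z) a
  nlinarith [mul_le_mul_of_nonneg_left hba' hC0]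

open Metric Set in
/-- The iterates of a transcendental entire function are unbounded on some disc. -/
theorem IsTranscendentalEntire.exists_le_norm_iterate {f : ℂ → ℂ}
    (hf : IsTranscendentalEntire f) :
    ∃ R > 0, ∀ n : ℕ, ∃ z ∈ closedBall (0 : ℂ) R, 2 ^ n * R ≤ ‖f^[n] z‖ := by
  obtain ⟨R₀, hR₀, h⟩ := hf.exists_sphere_subset_image
  refine ⟨R₀, hR₀, fun n => ?_⟩
  -- The induction needs every radius, since it passes from `R` to an uncontrolled `ρ ≥ 2 * R`.
  suffices ∀ R ≥ R₀, ∃ z ∈ closedBall (0 : ℂ) R, 2 ^ n * R ≤ ‖f^[n] z‖ from this R₀ le_rfl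
  induction n with
  | zero =>
    intro R hR
    have hn : |R| = R := abs_of_nonneg (hR₀.le.trans hR)
    exact ⟨R, by simp [hn], by simp [hn]⟩
  | succ n ih =>
    intro R hR
    obtain ⟨ρ, hρ, hsub⟩ := h R hR
    have hρpos : 0 < ρ := by linarith
    obtain ⟨z, hz, hzn⟩ := ih ρ (by linarith)
    obtain ⟨w, hw, hmax⟩ := Complex.exists_mem_frontier_isMaxOn_norm
      (isBounded_ball (x := (0 : ℂ)) (r := ρ)) ⟨0, mem_ball_self hρpos⟩
      (hf.1.iterate n).diffContOnCl
    rw [frontier_ball _ hρpos.ne'] at hw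
    rw [closure_ball _ hρpos.ne'] at hmax
    obtain ⟨x, hx, rfl⟩ := hsub hw
    refine ⟨x, hx, ?_⟩
    rw [Function.iterate_succ_apply]
    have h1 : ‖f^[n] z‖ ≤ ‖f^[n] (f x)‖ := hmax hz
    refine le_trans ?_ (hzn.trans h1)
    rw [pow_succ, mul_assoc]
    gcongr

/-! ### Normality and the conclusion -/

/-- If the iterates are normal near `z` and bounded at a nearby point, they are bounded
near `z`. -/
theorem IsNormalFamilyOn.eventually_norm_iterate_le {f : ℂ → ℂ} {U : Set ℂ}
    (hU : IsOpen U) (hN : IsNormalFamilyOn (Set.range fun n : ℕ => f^[n]) U) {z w : ℂ}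
    (hz : z ∈ U) (hw : w ∈ U) {B : ℝ} (hB : ∀ n, ‖f^[n] w‖ ≤ B) :
    ∃ M : ℝ, ∀ᶠ x in nhds z, ∀ n, ‖f^[n] x‖ ≤ M := by
  by_contra! hno
  have hex : ∀ k : ℕ, ∃ x ∈ Metric.ball z (1 / (k + 1)), ∃ n, (k : ℝ) < ‖f^[n] x‖ := by
    intro k
    have := (hno k).and_eventually (Metric.ball_mem_nhds z (Nat.one_div_pos_of_nat (n := k)))
    obtain ⟨x, hx, hxb⟩ := this.exists
    exact ⟨x, hxb, by simpa using hx⟩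
  choose x hx n hn using hex
  have hxz : Tendsto x atTop (nhds z) := by
    rw [tendsto_iff_dist_tendsto_zero]
    exact squeeze_zero (fun _ => dist_nonneg) (fun k => (Metric.mem_ball.1 (hx k)).le)
      tendsto_one_div_add_atTop_nhds_zero_nat
  obtain ⟨φ, hφ, h | h⟩ := hN (fun k => f^[n k]) (fun k => ⟨n k, rfl⟩)
  · obtain ⟨g, hg, hlim⟩ := h
    -- Locally uniform convergence allows moving arguments, so these values converge although their
    -- norms exceed `φ k`.
    have hconv : Tendsto (fun k => f^[n (φ k)] (x (φ k))) atTop (nhds (g z)) :=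
      hlim.tendsto_comp (hg.continuousOn z hz) hz
        (tendsto_nhdsWithin_iff.2 ⟨hxz.comp hφ.tendsto_atTop,
          (hxz.comp hφ.tendsto_atTop).eventually (hU.mem_nhds hz)⟩)
    have htop : Tendsto (fun k => ‖f^[n (φ k)] (x (φ k))‖) atTop atTop :=
      tendsto_atTop_mono (fun k => (hn (φ k)).le)
        (tendsto_natCast_atTop_atTop.comp hφ.tendsto_atTop)
    exact not_tendsto_nhds_of_tendsto_atTop htop _ hconv.norm
  · obtain ⟨k, hk⟩ := (h {w} (Set.singleton_subset_iff.2 hw) isCompact_singleton (B + 1)).exists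
    linarith [hk w rfl, hB (n (φ k))]

theorem mainTheorem1 (f : ℂ → ℂ) (hf : IsTranscendentalEntire f) :
    (juliaSet f).Nonempty := by
  by_contra hJ
  have hF : ∀ z, z ∈ fatouSet f := by
    rwa [Set.not_nonempty_iff_eq_empty, juliaSet, Set.compl_empty_iff, Set.eq_univ_iff_forall] at hJ
  obtain ⟨G, hG⟩ : ∃ G : Set ℂ, G = {z | ∃ M : ℝ, ∀ᶠ x in nhds z, ∀ n, ‖f^[n] x‖ ≤ M} := ⟨_, rfl⟩
  have hopen : IsOpen G := by
    rw [isOpen_iff_mem_nhds, hG]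
    rintro z ⟨M, hM⟩
    filter_upwards [hM.eventually_nhds] with x hx using ⟨M, hx⟩
  have hclosed : IsClosed G := by
    rw [← closure_subset_iff_isClosed]
    intro z hz
    obtain ⟨U, hU, -, hzU, hN⟩ := hF z
    obtain ⟨w, hwU, hwG⟩ := mem_closure_iff.1 hz U hU hzU
    rw [hG] at hwG ⊢
    obtain ⟨M, hM⟩ := hwG
    exact hN.eventually_norm_iterate_le hU hzU hwU hM.self_of_nhds
  have hne : G.Nonempty := by
    obtain ⟨c, hc⟩ := hf.exists_iterate_two_fixed
    obtain ⟨U, hU, -, hcU, hN⟩ := hF c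
    have hcn : ∀ n, f^[n] c = c ∨ f^[n] c = f c := by
      intro n
      induction n with
      | zero => exact Or.inl rfl
      | succ n ih =>
        rw [Function.iterate_succ_apply']
        rcases ih with h | h
        · exact Or.inr (by rw [h])
        · exact Or.inl (by rw [h, hc])
    refine ⟨c, hG ▸ hN.eventually_norm_iterate_le hU hcU hcU
      (B := max ‖c‖ ‖f c‖) fun n => ?_⟩
    rcases hcn n with h | h <;> simp [h]
  have huniv : G = Set.univ := IsClopen.eq_univ ⟨hclosed, hopen⟩ hne
  obtain ⟨R, hR, hgrow⟩ := hf.exists_le_norm_iterate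
  obtain ⟨M, hM⟩ : ∃ M : ℝ, ∀ x ∈ Metric.closedBall (0 : ℂ) R, ∀ n, ‖f^[n] x‖ ≤ M := by
    refine (isCompact_closedBall (0 : ℂ) R).induction_on
      (p := fun s => ∃ M : ℝ, ∀ x ∈ s, ∀ n, ‖f^[n] x‖ ≤ M) ⟨0, by simp⟩ ?_ ?_ ?_
    · rintro s t hst ⟨M, hM⟩
      exact ⟨M, fun x hx => hM x (hst hx)⟩
    · rintro s t ⟨M, hM⟩ ⟨N, hN⟩
      refine ⟨max M N, fun x hx n => ?_⟩
      rcases hx with hx | hx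
      · exact (hM x hx n).trans (le_max_left _ _)
      · exact (hN x hx n).trans (le_max_right _ _)
    · intro z _
      have hz : z ∈ G := huniv ▸ Set.mem_univ z
      rw [hG] at hz
      obtain ⟨M, hM⟩ := hz
      exact ⟨_, mem_nhdsWithin_of_mem_nhds hM, M, fun x hx => hx⟩
  obtain ⟨n, hn⟩ := pow_unbounded_of_one_lt (M / R) (one_lt_two (α := ℝ))
  obtain ⟨z, hz, hzn⟩ := hgrow n
  rw [div_lt_iff₀ hR] at hn
  linarith [hM z hz n]
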